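/- Let $(A,\vec b)$, $A\in\mathbb{R}^{s\times s}$, $\vec b\in\mathbb{R}^s$, be an $s$-stage Runge--Kutta scheme with abscissas $\vec c=A\vec e$, $\vec e=(1,\dots,1)^T$, and suppose that it is diagonally implicit (DIRK), i.e. $a_{ij}=0$ for $j>i$. Let $n_c$ be the number of distinct values among $c_1,\dots,c_s$. Let the scheme have classical order (at least) $p$, i.e. for smooth initial value problems the error of a single step of size $\Delta t$ is $O(\Delta t^{p+1})$ as $\Delta t\to 0$. The weak stage order (WSO) is the largest integer $q$ such that $$\vec b^{\,T}A^j\vec\tau^{(k)}=0\quad\text{for all } 0\le j\le s-1,\ 1\le k\le q,\qquad \vec\tau^{(k)}:=A\vec c^{\,k-1}-\tfrac1k\vec c^{\,k}$$ (powers of $\vec c$ are componentwise), and it is $\infty$ if this holds for every $q$. The scheme is called a GEDIRK scheme if $\vec c$ has a zero entry and $a_{\ell\ell}=0$, where $\ell$ is the index of the first zero entry of $\vec c$. Put $\kappa=1$ if the scheme is a GEDIRK scheme and $\kappa=0$ otherwise; put $\sigma=1$ if $A$ is invertible and the scheme is stiffly accurate (the last row of $A$ is $\vec b^{\,T}$),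 and $\sigma=0$ otherwise. **Theorem (Main Result for DIRK).** \begin{enumerate} \item If the WSO $q$ satisfies $q\le 2n_c-1$, then $$\left\lfloor\frac{q+\kappa}{2}\right\rfloor-\kappa+p\le s+1-\sigma .$$ In particular, if moreover $p=s-\sigma$, then $q\le 3$ if the scheme is not a GEDIRK scheme, and $q\le 4$ if it is. \item If $p=s+1-\sigma$, then (without any assumption on $n_c$) the WSO is at most $3$ if the scheme is not a GEDIRK scheme, and at most $4$ if it is. \end{enumerate} -/

import Mathlib

/-- An `s`-stage Runge-Kutta scheme, given by its Butcher matrix `A` and its weights `b`.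
The abscissas are always `c = A e` with `e = (1, …, 1)ᵀ`, see `RKScheme.c`. -/
structure RKScheme (s : ℕ) where
  A : Matrix (Fin s) (Fin s) ℝ
  b : Fin s → ℝ

namespace RKScheme

variable {s : ℕ}

/-- The abscissas `c = A e`, i.e. `c i = ∑ j, A i j`. -/
def c (M : RKScheme s) : Fin s → ℝ := fun i => ∑ j, M.A i j

/-- The number `n_c` of distinct abscissas. -/
noncomputable def numAbscissas (M : RKScheme s) : ℕ := (Finset.univ.image M.c).card

/-- Diagonally implicit scheme: `A` is lower triangular. -/
def IsDIRK (M : RKScheme s) : Prop := ∀ i j : Fin s, i < j → M.A i j = 0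

/-- Generalized EDIRK: a DIRK scheme for which `c` contains a zero and `a_ℓℓ = 0`, where `ℓ` is
the index of the first zero of `c`. -/
def IsGEDIRK (M : RKScheme s) : Prop :=
  M.IsDIRK ∧ ∃ l : Fin s, M.c l = 0 ∧ (∀ j : Fin s, j < l → M.c j ≠ 0) ∧ M.A l l = 0

/-- Stiffly accurate scheme: the last row of `A` equals `bᵀ`. -/
def IsStifflyAccurate (M : RKScheme s) : Prop :=
  ∃ l : Fin s, (l : ℕ) + 1 = s ∧ ∀ j : Fin s, M.A l j = M.b j

open Classical in
/-- `κ = 1` for GEDIRK schemes and `κ = 0` otherwise. -/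
noncomputable def kappa (M : RKScheme s) : ℕ := if M.IsGEDIRK then 1 else 0

open Classical in
/-- `σ = 1` if `A` is invertible and the scheme is stiffly accurate, and `σ = 0` otherwise. -/
noncomputable def sigma (M : RKScheme s) : ℕ :=
  if IsUnit M.A ∧ M.IsStifflyAccurate then 1 else 0

/-- The `k`-th stage order residual `τ⁽ᵏ⁾ = A c^(k-1) - c^k / k`, with componentwise powers
(used for `k ≥ 1` only). -/
noncomputable def tau (M : RKScheme s) (k : ℕ) : Fin s → ℝ :=
  fun i => (∑ j, M.A i j * M.c j ^ (k - 1)) - M.c i ^ k / k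

/-- The condition `S(ξ)`: `bᵀ A^j τ⁽ᵏ⁾ = 0` for `0 ≤ j ≤ s - 1` and `1 ≤ k ≤ ξ`. -/
def WSOCondition (M : RKScheme s) (ξ : ℕ) : Prop :=
  ∀ j k : ℕ, j < s → 1 ≤ k → k ≤ ξ → M.b ⬝ᵥ ((M.A ^ j).mulVec (M.tau k)) = 0

/-- The weak stage order: the largest `ξ` for which `S(ξ)` holds, and `∞` if `S(ξ)` holds for
all `ξ`. (`S(0)` is empty, and `S(ξ)` gets stronger as `ξ` grows.) -/
noncomputable def weakStageOrder (M : RKScheme s) : ℕ∞ :=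
  sSup {x : ℕ∞ | ∃ ξ : ℕ, x = (ξ : ℕ∞) ∧ M.WSOCondition ξ}

/-- The scheme has classical order (at least) `p`: for every smooth initial value problem
`u' = f(t, u)` in `ℝᵐ`, the error of a single step of size `h`, started on the exact solution at
`t₀`, is `O(h^(p+1))` as `h → 0⁺`.

Here `g h` are the stage values of the step of size `h`. For small `h` the stage equations have
exactly one solution near `(u t₀, …, u t₀)` (implicit function theorem), and the condition
`g h i → u t₀` says that this is the solution that the scheme uses. -/
def HasOrder (M : RKScheme s) (p : ℕ) : Prop :=
  ∀ (m : ℕ) (f : ℝ → EuclideanSpace ℝ (Fin m) → EuclideanSpace ℝ (Fin m))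
    (t₀ : ℝ) (u : ℝ → EuclideanSpace ℝ (Fin m))
    (g : ℝ → Fin s → EuclideanSpace ℝ (Fin m)),
    ContDiff ℝ ((⊤ : ℕ∞) : WithTop ℕ∞)
      (fun x : ℝ × EuclideanSpace ℝ (Fin m) => f x.1 x.2) →
    (∀ᶠ t in nhds t₀, HasDerivAt u (f t (u t)) t) →
    (∀ᶠ h in nhdsWithin (0 : ℝ) (Set.Ioi 0), ∀ i : Fin s,
      g h i = u t₀ + h • ∑ j, M.A i j • f (t₀ + M.c j * h) (g h j)) →
    (∀ i : Fin s,
      Filter.Tendsto (fun h => g h i) (nhdsWithin (0 : ℝ) (Set.Ioi 0)) (nhds (u t₀))) →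
    Asymptotics.IsBigO (nhdsWithin (0 : ℝ) (Set.Ioi 0))
      (fun h : ℝ => (u t₀ + h • ∑ j, M.b j • f (t₀ + M.c j * h) (g h j)) - u (t₀ + h))
      (fun h : ℝ => h ^ (p + 1))

end RKScheme

/-!
Let `W` be the space of vectors `v` with `bᵀ A^j v = 0` for all `j`, and let `d = s - dim W`. The
claim is a comparison of an upper and a lower bound for `dim W`.

Upper bound. Order `p` makes the stability function `R` agree with `exp` up to `z ^ p`. As `A` has
real eigenvalues, some real-rooted monic `χ` of degree at most `d` has `χ(A) ℝˢ ⊆ W`; for its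
reversal `Q`, the coefficients of `Q R` vanish beyond degree `d` (from degree `d` on if `σ = 1`),
hence those of `Q exp` vanish from there up to degree `p`. But no two consecutive coefficients of
`Q exp` vanish: differentiation turns `Q exp` into `(Q + Q') exp`, and `Q ↦ Q + Q'` preserves
real-rootedness and, by Laguerre's inequality, creates no new double zeros, whereas `Q 0 ≠ 0`.
Hence `p ≤ d + 1 - σ`.

Lower bound. Weak stage order `q` puts the vectors `A P'(c) - P(c)` into `W` for all polynomials `P`
of degree at most `q` with `P 0 = 0`. If `A` is lower triangular and `P` has double zeros at the
abscissas before a new one, then the first nonzero entry of this vector sits at the new abscissa,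
so `W` contains linearly independent vectors, one per new abscissa within the degree bound.
-/

open Polynomial
open scoped Matrix PowerSeries

section LaguerreInequality

variable {K : Type*} [Field K] [LinearOrder K] [IsStrictOrderedRing K] {P : K[X]}

theorem eval_mul_eval_derivative_derivative_le_sq (hP : P.Splits) (x : K) :
    P.eval x * P.derivative.derivative.eval x ≤ P.derivative.eval x ^ 2 := by
  induction hn : P.natDegree generalizing P with
  | zero =>
    rw [eq_C_of_natDegree_eq_zero hn]
    simp
  | succ n ih =>
    obtain ⟨r, hr⟩ := hP.exists_eval_eq_zero fun h => by
      simp [natDegree_eq_of_degree_eq_some h] at hn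
    obtain ⟨R, rfl⟩ := dvd_iff_isRoot.2 hr
    have hR0 : R ≠ 0 := by rintro rfl; simp at hn
    have hR := ih (splits_X_sub_C_mul_iff.1 hP)
      (by rw [natDegree_mul (X_sub_C_ne_zero r) hR0, natDegree_X_sub_C] at hn; lia)
    simp only [derivative_mul, derivative_add, derivative_sub, derivative_X, derivative_C,
      eval_add, eval_mul, eval_sub, eval_X, eval_C, sub_zero, one_mul]
    linear_combination sq_nonneg (R.eval x) + mul_le_mul_of_nonneg_left hR (sq_nonneg (x - r))

theorem eval_mul_eval_derivative_derivative_lt_sq (hP : P.Splits) (hn : P.natDegree ≠ 0) {x : K}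
    (hx : P.eval x ≠ 0) :
    P.eval x * P.derivative.derivative.eval x < P.derivative.eval x ^ 2 := by
  obtain ⟨r, hr⟩ := hP.exists_eval_eq_zero fun h => hn (natDegree_eq_of_degree_eq_some h)
  obtain ⟨R, rfl⟩ := dvd_iff_isRoot.2 hr
  have hRx : R.eval x ≠ 0 := fun h => hx (by rw [eval_mul, h, mul_zero])
  have hR := eval_mul_eval_derivative_derivative_le_sq (splits_X_sub_C_mul_iff.1 hP) x
  simp only [derivative_mul, derivative_add, derivative_sub, derivative_X, derivative_C,
    eval_add, eval_mul, eval_sub, eval_X, eval_C, sub_zero, one_mul]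
  linear_combination sq_pos_of_ne_zero hRx + mul_le_mul_of_nonneg_left hR (sq_nonneg (x - r))

theorem double_root_of_double_root_add_derivative (hP : P.Splits) {x : K}
    (h0 : (P + derivative P).eval x = 0) (h1 : (derivative (P + derivative P)).eval x = 0) :
    P.eval x = 0 ∧ (derivative P).eval x = 0 := by
  simp only [derivative_add, eval_add] at h0 h1
  suffices hx : P.eval x = 0 from ⟨hx, by linear_combination h0 - hx⟩
  by_contra hx
  have hn : P.natDegree ≠ 0 := fun hn => hx <| by
    simpa [derivative_of_natDegree_zero hn] using h0
  refine (eval_mul_eval_derivative_derivative_lt_sq hP hn hx).ne ?_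
  linear_combination P.eval x * h1 - P.derivative.eval x * h0

end LaguerreInequality

theorem im_sum_one_div_sub_ofReal (z : ℂ) (m : Multiset ℝ) :
    (m.map fun r : ℝ => 1 / (z - r)).sum.im =
      -(m.map fun r : ℝ => (Complex.normSq (z - r))⁻¹).sum * z.im := by
  induction m using Multiset.induction with
  | empty => simp
  | cons r m ih =>
    simp only [Multiset.map_cons, Multiset.sum_cons, Complex.add_im, ih]
    simp only [one_div, Complex.inv_im, Complex.sub_im, Complex.ofReal_im]
    ring

theorem splits_add_derivative {P : ℝ[X]} (hP : P.Splits) : (P + derivative P).Splits := by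
  refine Splits.of_splits_map_of_injective Complex.ofRealHom.injective (IsAlgClosed.splits _) ?_
  intro z hz
  by_contra hzr
  have him : z.im ≠ 0 := fun h => hzr ⟨z.re, Complex.ext rfl h.symm⟩
  have hPz : (P.map Complex.ofRealHom).eval z ≠ 0 := fun h =>
    hzr (hP.mem_range_of_isRoot (by rintro rfl; simp at hz) h)
  have hlog : (P.roots.map fun r : ℝ => 1 / (z - r)).sum = -1 := by
    have hroot : (P.map Complex.ofRealHom).eval z +
        (derivative (P.map Complex.ofRealHom)).eval z = 0 := by
      simpa only [Polynomial.map_add, derivative_map, IsRoot.def, eval_add]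
        using isRoot_of_mem_roots hz
    have hsum := (hP.map Complex.ofRealHom).eval_derivative_div_eval_of_ne_zero hPz
    rw [hP.roots_map, Multiset.map_map, eq_neg_of_add_eq_zero_right hroot, neg_div,
      div_self hPz] at hsum
    exact hsum.symm
  have hnormSq : (P.roots.map fun r : ℝ => (Complex.normSq (z - r))⁻¹).sum = 0 := by
    have him_sum := im_sum_one_div_sub_ofReal z P.roots
    rw [hlog, Complex.neg_im, Complex.one_im, neg_zero, eq_comm, mul_eq_zero, neg_eq_zero]
      at him_sum
    exact him_sum.resolve_right him
  have hroots : P.roots = 0 := Multiset.eq_zero_of_forall_notMem fun r hr => by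
    have hne : z - r ≠ 0 := fun h => him (by simpa using congrArg Complex.im h)
    have hle := Multiset.single_le_sum
      (Multiset.forall_mem_map_iff.2 fun (x : ℝ) _ => inv_nonneg.2 (Complex.normSq_nonneg (z - x)))
      _
      (Multiset.mem_map_of_mem (fun r : ℝ => (Complex.normSq (z - r))⁻¹) hr)
    exact (inv_pos.2 (Complex.normSq_pos.2 hne)).not_ge (hle.trans_eq hnormSq)
  simp [hroots] at hlog

theorem splits_reverse {K : Type*} [Field K] {P : K[X]} (hP : P.Splits) : P.reverse.Splits := by
  rw [hP.eq_prod_roots, reverse_mul_of_domain, reverse_C]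
  refine Splits.C_mul ?_ _
  induction P.roots using Multiset.induction with
  | empty => simpa only [Multiset.map_zero, Multiset.prod_zero, ← C_1, reverse_C] using Splits.C _
  | cons r m ih =>
    rw [Multiset.map_cons, Multiset.prod_cons, reverse_mul_of_domain]
    exact (Splits.of_natDegree_le_one
      ((reverse_natDegree_le _).trans (natDegree_X_sub_C_le r))).mul ih

theorem derivative_coe_mul_exp {K : Type*} [CommRing K] [Algebra ℚ K] (P : K[X]) :
    d⁄dX K ((P : K⟦X⟧) * PowerSeries.exp K) =
      ((P + derivative P : K[X]) : K⟦X⟧) * PowerSeries.exp K := by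
  rw [Derivation.leibniz, PowerSeries.derivative_exp, PowerSeries.derivative_coe, coe_add]
  simp only [smul_eq_mul]
  ring

theorem coeff_add_derivative_mul_exp {K : Type*} [CommRing K] [Algebra ℚ K] {P : K[X]} {n : ℕ}
    (h : PowerSeries.coeff (n + 1) ((P : K⟦X⟧) * PowerSeries.exp K) = 0) :
    PowerSeries.coeff n (((P + derivative P : K[X]) : K⟦X⟧) * PowerSeries.exp K) = 0 := by
  rw [← derivative_coe_mul_exp, PowerSeries.coeff_derivative, h, zero_mul]

theorem double_root_of_coeff_mul_exp_eq_zero {P : ℝ[X]} (hP : P.Splits) {n : ℕ}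
    (h0 : PowerSeries.coeff n ((P : ℝ⟦X⟧) * PowerSeries.exp ℝ) = 0)
    (h1 : PowerSeries.coeff (n + 1) ((P : ℝ⟦X⟧) * PowerSeries.exp ℝ) = 0) :
    P.eval 0 = 0 ∧ (derivative P).eval 0 = 0 := by
  induction n generalizing P with
  | zero =>
    have hroot : P.eval 0 = 0 := by simpa [coeff_zero_eq_eval_zero] using h0
    have hroot' := coeff_add_derivative_mul_exp h1
    exact ⟨hroot, by simpa [hroot, coeff_zero_eq_eval_zero] using hroot'⟩
  | succ n ih =>
    obtain ⟨hroot, hroot'⟩ := ih (splits_add_derivative hP) (coeff_add_derivative_mul_exp h0)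
      (coeff_add_derivative_mul_exp h1)
    exact double_root_of_double_root_add_derivative hP hroot hroot'

theorem le_of_coeff_mul_eq_zero_of_coeff_eq_coeff_exp {P : ℝ[X]} (hP : P.Splits)
    (hP0 : P.eval 0 ≠ 0) {R : ℝ⟦X⟧} {p k : ℕ}
    (hR : ∀ n ≤ p, PowerSeries.coeff n R = PowerSeries.coeff n (PowerSeries.exp ℝ))
    (hPR : ∀ n, k ≤ n → PowerSeries.coeff n ((P : ℝ⟦X⟧) * R) = 0) : p ≤ k := by
  by_contra! hk
  have hexp (n : ℕ) (hkn : k ≤ n) (hnp : n ≤ p) :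
      PowerSeries.coeff n ((P : ℝ⟦X⟧) * PowerSeries.exp ℝ) = 0 := by
    rw [← hPR n hkn, PowerSeries.coeff_mul, PowerSeries.coeff_mul]
    refine Finset.sum_congr rfl fun ij hij => ?_
    rw [hR _ ((Finset.HasAntidiagonal.antidiagonal.snd_le hij).trans hnp)]
  exact hP0 (double_root_of_coeff_mul_exp_eq_zero hP (hexp k le_rfl hk.le)
    (hexp (k + 1) k.le_succ hk)).1

section Unobservable

variable {K V : Type*}

/-- The vectors on whose whole forward orbit under `f` the functional `φ` vanishes: the unobservable
subspace, in the terms of control theory, of the system with dynamics `f` and output `φ`. -/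
def unobservableSubmodule [CommSemiring K] [AddCommMonoid V] [Module K V] (f : Module.End K V)
    (φ : Module.Dual K V) : Submodule K V :=
  ⨅ j : ℕ, LinearMap.ker (φ ∘ₗ f ^ j)

namespace unobservableSubmodule

section CommSemiring

variable [CommSemiring K] [AddCommMonoid V] [Module K V] {f : Module.End K V} {φ : Module.Dual K V}
  {v : V}

theorem mem_iff : v ∈ unobservableSubmodule f φ ↔ ∀ j : ℕ, φ ((f ^ j) v) = 0 := by
  simp [unobservableSubmodule]

theorem le_comap : unobservableSubmodule f φ ≤ (unobservableSubmodule f φ).comap f :=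
  fun v hv => mem_iff.2 fun j => by
    rw [← Module.End.mul_apply, ← pow_succ]
    exact mem_iff.1 hv (j + 1)

end CommSemiring

theorem mem_of_forall_lt_finrank [CommRing K] [Nontrivial K] [AddCommGroup V] [Module K V]
    [Module.Free K V] [Module.Finite K V] {f : Module.End K V} {φ : Module.Dual K V} {v : V}
    (h : ∀ j < Module.finrank K V, φ ((f ^ j) v) = 0) : v ∈ unobservableSubmodule f φ := by
  refine mem_iff.2 fun j => ?_
  have hdeg := degree_modByMonic_lt (X ^ j) f.charpoly_monic
  rw [degree_eq_natDegree f.charpoly_monic.ne_zero, f.charpoly_natDegree] at hdeg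
  rw [f.pow_eq_aeval_mod_charpoly, aeval_def, eval₂_eq_sum, sum_def, LinearMap.sum_apply, map_sum]
  refine Finset.sum_eq_zero fun i hi => ?_
  rw [Module.End.mul_apply, Module.algebraMap_end_apply, map_smul,
    h i (by exact_mod_cast (le_degree_of_mem_supp i hi).trans_lt hdeg), smul_zero]

variable [Field K] [AddCommGroup V] [Module K V] [FiniteDimensional K V] {f : Module.End K V}

theorem comp_le_of_injective (hf : Function.Injective f) (ψ : Module.Dual K V) :
    unobservableSubmodule f (ψ ∘ₗ f) ≤ unobservableSubmodule f ψ := by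
  intro v hv
  have hsurj := LinearMap.injective_iff_surjective.1
    ((LinearMap.injective_restrict_iff (le_comap (φ := ψ ∘ₗ f))).2
      (by rw [LinearMap.ker_eq_bot.2 hf]; exact disjoint_bot_right))
  obtain ⟨⟨w, hw⟩, hwv⟩ := hsurj ⟨v, hv⟩
  obtain rfl : f w = v := congrArg Subtype.val hwv
  refine mem_iff.2 fun j => ?_
  rw [← Module.End.mul_apply, ← pow_succ, pow_succ', Module.End.mul_apply]
  exact mem_iff.1 hw j

end unobservableSubmodule

theorem mkQ_aeval_apply [CommRing K] [AddCommGroup V] [Module K V] {f : Module.End K V}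
    {W : Submodule K V} (hW : W ≤ W.comap f) (χ : K[X]) (v : V) :
    W.mkQ (aeval f χ v) = aeval (W.mapQ W f hW) χ (W.mkQ v) := by
  simp only [aeval_eq_sum_range, LinearMap.sum_apply, LinearMap.smul_apply, map_sum, map_smul]
  refine Finset.sum_congr rfl fun i _ => ?_
  rw [← Submodule.mapQ_pow W hW i, Submodule.mkQ_apply, Submodule.mkQ_apply, Submodule.mapQ_apply]

theorem exists_monic_splits_aeval_mem [Field K] [AddCommGroup V] [Module K V]
    [FiniteDimensional K V] {f : Module.End K V} (hf : f.charpoly.Splits) {W : Submodule K V}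
    (hW : W ≤ W.comap f) :
    ∃ χ : K[X], χ.Monic ∧ χ.Splits ∧ χ.natDegree + Module.finrank K W ≤ Module.finrank K V ∧
      ∀ v, aeval f χ v ∈ W := by
  set g := W.mapQ W f hW
  have hdvd : minpoly K g ∣ f.charpoly := minpoly.dvd _ _ <| LinearMap.ext fun x => by
    obtain ⟨v, rfl⟩ := W.mkQ_surjective x
    rw [← mkQ_aeval_apply, f.aeval_self_charpoly, LinearMap.zero_apply, map_zero,
      LinearMap.zero_apply]
  have hdeg : (minpoly K g).natDegree ≤ Module.finrank K (V ⧸ W) := by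
    rw [← g.charpoly_natDegree]
    exact natDegree_le_of_dvd g.minpoly_dvd_charpoly g.charpoly_monic.ne_zero
  refine ⟨minpoly K g, minpoly.monic (Algebra.IsIntegral.isIntegral g),
    hf.of_dvd f.charpoly_monic.ne_zero hdvd, ?_, fun v => ?_⟩
  · rw [← W.finrank_quotient_add_finrank]
    gcongr
  · rw [← Submodule.Quotient.mk_eq_zero, ← Submodule.mkQ_apply, mkQ_aeval_apply hW,
      minpoly.aeval, LinearMap.zero_apply]

theorem coeff_reverse_mul_mk_dual_pow [CommSemiring K] [AddCommMonoid V] [Module K V]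
    (f : Module.End K V) (φ : Module.Dual K V) (χ : K[X]) (v : V) {n : ℕ} (hn : χ.natDegree ≤ n) :
    PowerSeries.coeff n ((χ.reverse : K⟦X⟧) * PowerSeries.mk fun j => φ ((f ^ j) v)) =
      φ ((f ^ (n - χ.natDegree)) (aeval f χ v)) := by
  obtain ⟨k, rfl⟩ := Nat.exists_eq_add_of_le hn
  have hzero (i : ℕ) (hi : i ∉ Finset.range χ.natDegree.succ) : χ.reverse.coeff i = 0 :=
    coeff_eq_zero_of_natDegree_lt <| χ.reverse_natDegree_le.trans_lt <| by
      simpa [Nat.lt_succ_iff] using hi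
  simp only [PowerSeries.coeff_mul, PowerSeries.coeff_mk, coeff_coe,
    Finset.Nat.sum_antidiagonal_eq_sum_range_succ_mk]
  rw [← Finset.sum_subset (Finset.range_mono (Nat.succ_le_succ hn)) fun i _ hi => by
      rw [hzero i hi, zero_mul], Nat.succ_eq_add_one, ← Finset.sum_range_reflect,
    aeval_eq_sum_range, LinearMap.sum_apply, map_sum, map_sum]
  refine Finset.sum_congr rfl fun i hi => ?_
  have hi : i ≤ χ.natDegree := Finset.mem_range_succ_iff.1 hi
  rw [add_tsub_cancel_left, LinearMap.smul_apply, map_smul, map_smul, smul_eq_mul,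
    ← Module.End.mul_apply, ← pow_add, coeff_reverse, revAt_le (by lia)]
  congr <;> lia

end Unobservable

theorem card_le_finrank_of_forall_exists_pivot {K ι : Type*} [Field K] [Finite ι] [LinearOrder ι]
    (W : Submodule K (ι → K)) (T : Finset ι)
    (hT : ∀ k ∈ T, ∃ w ∈ W, w k ≠ 0 ∧ ∀ j < k, w j = 0) : T.card ≤ Module.finrank K W := by
  choose! w hW hne hzero using hT
  have hli : LinearIndependent K fun k : T => (⟨w k, hW k k.2⟩ : W) := by
    rw [Fintype.linearIndependent_iff]
    intro g hg k
    induction k using WellFoundedLT.induction with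
    | ind k ih =>
      have hk : ∑ j : T, g j * w j k = 0 := by
        simpa [Finset.sum_apply] using congrFun (congrArg Subtype.val hg) (k : ι)
      rw [Fintype.sum_eq_single k fun j hj => ?_] at hk
      · exact (mul_eq_zero.1 hk).resolve_right (hne k k.2)
      · rcases lt_or_gt_of_ne hj with hj | hj
        · rw [ih j hj, zero_mul]
        · rw [hzero j j.2 k hj, mul_zero]
  simpa using hli.fintype_card_le_finrank

theorem exists_card_image_filter_lt_eq {ι α : Type*} [LinearOrder ι] [DecidableEq α] (c : ι → α)
    {s : Finset ι} {r : ℕ} (hr : r < (s.image c).card) :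
    ∃ k ∈ s, c k ∉ {j ∈ s | j < k}.image c ∧ ({j ∈ s | j < k}.image c).card = r := by
  induction s using Finset.induction_on_max with
  | empty => simp at hr
  | insert a s ha ih =>
    by_cases hrs : r < (s.image c).card
    · obtain ⟨k, hk, hck⟩ := ih hrs
      refine ⟨k, Finset.mem_insert_of_mem hk, ?_⟩
      rwa [Finset.filter_insert, if_neg (ha k hk).not_gt]
    · have hcard := hr
      rw [Finset.image_insert, Finset.card_insert_eq_ite] at hcard
      rw [← Finset.filter_true_of_mem ha] at hrs hcard ⊢
      refine ⟨a, Finset.mem_insert_self a _, ?_⟩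
      rw [Finset.filter_insert, if_neg (lt_irrefl a), Finset.filter_filter]
      simp only [and_self]
      split_ifs at hcard with hmem
      · exact absurd hcard hrs
      · exact ⟨hmem, by lia⟩

theorem exists_double_zeros_and_eval_ne_zero {K : Type*} [Field K] [DecidableEq K]
    {S : Finset K} {x : K} (hx : x ∉ S) :
    ∃ P : K[X], P.natDegree + 1 ≤ 2 * S.card + (if 0 ∈ insert x S then 1 else 2) ∧
      (x ≠ 0 → P.eval 0 = 0) ∧ (∀ y ∈ S, P.eval y = 0 ∧ (derivative P).eval y = 0) ∧
      P.eval x ≠ 0 := by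
  set Z : K[X] := if 0 ∈ insert x S then 1 else X with hZ
  have hzeros (y : K) (hy : y ∈ S) : (Lagrange.nodal S id ^ 2 * Z).eval y = 0 ∧
      (derivative (Lagrange.nodal S id ^ 2 * Z)).eval y = 0 := by
    have hnodal : (Lagrange.nodal S id).eval y = 0 := Lagrange.eval_nodal_at_node (v := id) hy
    simp [derivative_mul, derivative_pow, hnodal]
  refine ⟨Lagrange.nodal S id ^ 2 * Z, ?_, fun hx0 => ?_, hzeros, ?_⟩
  · have hdeg := natDegree_mul_le (p := Lagrange.nodal S id ^ 2) (q := Z)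
    have hZdeg : Z.natDegree + 1 ≤ if 0 ∈ insert x S then 1 else 2 := by
      rw [hZ]
      split_ifs <;> simp
    rw [natDegree_pow, Lagrange.natDegree_nodal] at hdeg
    lia
  · by_cases h0 : (0 : K) ∈ S
    · exact (hzeros 0 h0).1
    · simp [hZ, hx0.symm, h0]
  · have hnodal : (Lagrange.nodal S id).eval x ≠ 0 :=
      Lagrange.eval_nodal_not_at_node fun y hy => (ne_of_mem_of_not_mem hy hx).symm
    have hZx : Z.eval x ≠ 0 := by
      rw [hZ]
      split_ifs with h0
      · simp
      · rw [eval_X]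
        rintro rfl
        exact h0 (Finset.mem_insert_self _ _)
    simp [hnodal, hZx]

theorem exists_double_zeros_and_mul_eval_derivative_ne {K : Type*} [Field K] [DecidableEq K]
    {S : Finset K} {x a : K} (hx : x ∉ S) (ha : x = 0 → a ≠ 0) :
    ∃ P : K[X], P.natDegree ≤ 2 * S.card + (if 0 ∈ insert x S then 1 else 2) ∧ P.eval 0 = 0 ∧
      (∀ y ∈ S, P.eval y = 0 ∧ (derivative P).eval y = 0) ∧
      a * (derivative P).eval x ≠ P.eval x := by
  obtain ⟨B, hdeg, hB0, hzeros, hBx⟩ := exists_double_zeros_and_eval_ne_zero hx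
  by_cases ha0 : a = 0
  · refine ⟨B, by lia, hB0 fun h => ha h ha0, hzeros, ?_⟩
    rw [ha0, zero_mul]
    exact hBx.symm
  · refine ⟨B * (X - C x), ?_, ?_, fun y hy => ?_, ?_⟩
    · exact (natDegree_mul_le.trans (by rw [natDegree_X_sub_C])).trans hdeg
    · by_cases hx0 : x = 0
      · simp [hx0]
      · simp [hB0 hx0]
    · simp [derivative_mul, hzeros y hy]
    · simp [derivative_mul, ha0, hBx]

namespace RKScheme

variable {s : ℕ} {M : RKScheme s}

/-- The vectors `v` with `bᵀ A^j v = 0` for every `j`. -/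
noncomputable def unobservable (M : RKScheme s) : Submodule ℝ (Fin s → ℝ) :=
  unobservableSubmodule (Matrix.toLin' M.A) (dotProductEquiv ℝ (Fin s) M.b)

/-- The Taylor series `1 + z bᵀ (I - z A)⁻¹ e` of the stability function of the scheme. -/
noncomputable def stabilityFunction (M : RKScheme s) : ℝ⟦X⟧ :=
  1 + PowerSeries.X * PowerSeries.mk fun j => M.b ⬝ᵥ (M.A ^ j *ᵥ 1)

/-- Order at least `p` for autonomous linear problems `u' = L u`, on which one step multiplies `u`
by the stability function of `h L`. -/
def HasLinearOrder (M : RKScheme s) (p : ℕ) : Prop :=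
  ∀ n ≤ p, PowerSeries.coeff n M.stabilityFunction = PowerSeries.coeff n (PowerSeries.exp ℝ)

theorem mem_unobservable_of_forall_lt {v : Fin s → ℝ}
    (h : ∀ j < s, M.b ⬝ᵥ (M.A ^ j *ᵥ v) = 0) : v ∈ M.unobservable :=
  unobservableSubmodule.mem_of_forall_lt_finrank fun j hj => by
    rw [Module.finrank_fin_fun] at hj
    rw [← Matrix.toLin'_pow, Matrix.toLin'_apply, dotProductEquiv_apply_apply, h j hj]

theorem coeff_succ_stabilityFunction (M : RKScheme s) (n : ℕ) :
    PowerSeries.coeff (n + 1) M.stabilityFunction = M.b ⬝ᵥ (M.A ^ n *ᵥ 1) := by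
  simp [stabilityFunction]

theorem stabilityFunction_eq_mk {l : Fin s} (hl : ∀ j, M.A l j = M.b j) :
    M.stabilityFunction = PowerSeries.mk fun j => (M.A ^ j *ᵥ 1) l := by
  ext (_ | n)
  · simp [stabilityFunction]
  · rw [coeff_succ_stabilityFunction, PowerSeries.coeff_mk, pow_succ', ← Matrix.mulVec_mulVec,
      Matrix.mulVec, funext hl]

theorem HasLinearOrder.le_of_coeff_reverse_mul_eq_zero {p k : ℕ} (hp : M.HasLinearOrder p)
    {χ : ℝ[X]} (hχ : χ.Monic) (hsplits : χ.Splits)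
    (h : ∀ n, k ≤ n → PowerSeries.coeff n ((χ.reverse : ℝ⟦X⟧) * M.stabilityFunction) = 0) :
    p ≤ k :=
  le_of_coeff_mul_eq_zero_of_coeff_eq_coeff_exp (splits_reverse hsplits)
    (by rw [← coeff_zero_eq_eval_zero, coeff_zero_reverse, hχ.leadingCoeff]; exact one_ne_zero)
    hp h

theorem HasLinearOrder.le_natDegree_succ {p : ℕ} (hp : M.HasLinearOrder p) {χ : ℝ[X]}
    (hχ : χ.Monic) (hsplits : χ.Splits)
    (hmem : ∀ v, aeval (Matrix.toLin' M.A) χ v ∈ M.unobservable) : p ≤ χ.natDegree + 1 := by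
  refine hp.le_of_coeff_reverse_mul_eq_zero hχ hsplits fun n hn => ?_
  obtain ⟨n, rfl⟩ := Nat.exists_eq_add_of_le' (Nat.one_le_of_lt hn)
  have hn : χ.natDegree ≤ n := Nat.le_of_succ_le_succ hn
  have htail : PowerSeries.coeff n ((χ.reverse : ℝ⟦X⟧) *
      PowerSeries.mk fun j => M.b ⬝ᵥ (M.A ^ j *ᵥ 1)) = 0 := by
    have h := coeff_reverse_mul_mk_dual_pow (Matrix.toLin' M.A) (dotProductEquiv ℝ (Fin s) M.b) χ
      1 hn
    rw [unobservableSubmodule.mem_iff.1 (hmem 1)] at h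
    simpa only [← Matrix.toLin'_pow, Matrix.toLin'_apply, dotProductEquiv_apply_apply] using h
  have hhead : χ.reverse.coeff (n + 1) = 0 :=
    coeff_eq_zero_of_natDegree_lt (χ.reverse_natDegree_le.trans_lt (Nat.lt_succ_of_le hn))
  rw [stabilityFunction, mul_add, mul_one, map_add, coeff_coe, hhead, mul_left_comm,
    PowerSeries.coeff_succ_X_mul, htail, add_zero]

theorem HasLinearOrder.le_natDegree {p : ℕ} (hp : M.HasLinearOrder p) (hA : IsUnit M.A) {l : Fin s}
    (hl : ∀ j, M.A l j = M.b j) {χ : ℝ[X]} (hχ : χ.Monic) (hsplits : χ.Splits)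
    (hmem : ∀ v, aeval (Matrix.toLin' M.A) χ v ∈ M.unobservable) : p ≤ χ.natDegree := by
  set f := Matrix.toLin' M.A
  set ψ : Module.Dual ℝ (Fin s → ℝ) := LinearMap.proj l
  have hf : Function.Injective f := Matrix.mulVec_injective_of_isUnit hA
  have hψ : dotProductEquiv ℝ (Fin s) M.b = ψ ∘ₗ f := LinearMap.ext fun v => by
    rw [dotProductEquiv_apply_apply, ← funext hl]
    rfl
  have hle : M.unobservable ≤ unobservableSubmodule f ψ := by
    rw [unobservable, hψ]
    exact unobservableSubmodule.comp_le_of_injective hf ψ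
  refine hp.le_of_coeff_reverse_mul_eq_zero hχ hsplits fun n hn => ?_
  have h := coeff_reverse_mul_mk_dual_pow f ψ χ 1 hn
  rw [unobservableSubmodule.mem_iff.1 (hle (hmem 1))] at h
  simpa only [stabilityFunction_eq_mk hl, f, ψ, ← Matrix.toLin'_pow, Matrix.toLin'_apply,
    LinearMap.proj_apply] using h

theorem HasLinearOrder.add_finrank_unobservable_add_sigma_le {p : ℕ} (hp : M.HasLinearOrder p)
    (hA : M.A.charpoly.Splits) :
    p + Module.finrank ℝ M.unobservable + M.sigma ≤ s + 1 := by
  obtain ⟨χ, hχ, hsplits, hdeg, hmem⟩ := exists_monic_splits_aeval_mem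
    (f := Matrix.toLin' M.A) (W := M.unobservable) (by rwa [Matrix.charpoly_toLin'])
    unobservableSubmodule.le_comap
  rw [Module.finrank_fin_fun] at hdeg
  rw [sigma]
  split_ifs with hσ
  · obtain ⟨hU, l, -, hl⟩ := hσ
    have := hp.le_natDegree hU hl hχ hsplits hmem
    lia
  · have := hp.le_natDegree_succ hχ hsplits hmem
    lia

theorem IsDIRK.charpoly_splits (hM : M.IsDIRK) : M.A.charpoly.Splits := by
  have hupper : M.Aᵀ.IsUpperTriangular := fun i j hij => hM j i hij
  rw [← Matrix.charpoly_transpose, Matrix.charpoly_of_isUpperTriangular _ hupper]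
  exact Splits.prod fun i _ => Splits.X_sub_C _

/-- The linear vector field of the chain of equations `u₀' = 0`, `uₖ₊₁' = uₖ`. -/
def shiftField (n : ℕ) (x : EuclideanSpace ℝ (Fin (n + 1))) : EuclideanSpace ℝ (Fin (n + 1)) :=
  WithLp.toLp 2 (Fin.cons 0 fun k : Fin n => x k.castSucc)

/-- The solution `uₖ(t) = t ^ k / k!` of the chain `shiftField`. -/
noncomputable def shiftSolution (n : ℕ) (t : ℝ) : EuclideanSpace ℝ (Fin (n + 1)) :=
  WithLp.toLp 2 fun k => t ^ (k : ℕ) / (k : ℕ).factorial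

theorem shiftField_apply_zero (n : ℕ) (x : EuclideanSpace ℝ (Fin (n + 1))) :
    shiftField n x 0 = 0 :=
  rfl

theorem shiftField_apply_succ {n : ℕ} (x : EuclideanSpace ℝ (Fin (n + 1))) (k : Fin n) :
    shiftField n x k.succ = x k.castSucc :=
  rfl

theorem shiftSolution_apply (n : ℕ) (t : ℝ) (k : Fin (n + 1)) :
    shiftSolution n t k = t ^ (k : ℕ) / (k : ℕ).factorial :=
  rfl

theorem contDiff_shiftField (n : ℕ) {r : WithTop ℕ∞} : ContDiff ℝ r (shiftField n) :=
  contDiff_euclidean.2 fun k => by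
    cases k using Fin.cases with
    | zero => exact contDiff_const
    | succ k => exact contDiff_euclidean.1 contDiff_id k.castSucc

theorem hasDerivAt_shiftSolution (n : ℕ) (t : ℝ) :
    HasDerivAt (shiftSolution n) (shiftField n (shiftSolution n t)) t := by
  have hcoord : HasDerivAt (fun t (k : Fin (n + 1)) => shiftSolution n t k)
      (fun k => shiftField n (shiftSolution n t) k) t := hasDerivAt_pi.2 fun k => by
    cases k using Fin.cases with
    | zero => simpa [shiftSolution_apply, shiftField_apply_zero] using hasDerivAt_const t (1 : ℝ)
    | succ k =>
      simp only [shiftSolution_apply, shiftField_apply_succ, Fin.val_succ, Fin.val_castSucc]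
      convert! (hasDerivAt_pow ((k : ℕ) + 1) t).div_const (((k : ℕ) + 1).factorial : ℝ) using 1
      rw [Nat.factorial_succ, Nat.cast_mul, mul_div_mul_left _ _ (by positivity),
        Nat.add_sub_cancel]
  exact (PiLp.hasFDerivAt_toLp 2 _).comp_hasDerivAt t hcoord

theorem eq_zero_of_const_mul_pow_isBigO_pow {c : ℝ} {m n : ℕ} (hmn : m < n)
    (h : (fun x : ℝ => c * x ^ m) =O[nhdsWithin 0 (Set.Ioi 0)] fun x => x ^ n) : c = 0 := by
  by_contra hc
  have hlittle := h.trans_isLittleO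
    ((Asymptotics.isLittleO_pow_pow (𝕜 := ℝ) hmn).mono nhdsWithin_le_nhds)
  refine Asymptotics.isLittleO_irrefl ?_ ((Asymptotics.isLittleO_const_mul_left_iff hc).1 hlittle)
  refine (eventually_mem_nhdsWithin.mono fun x hx => ?_).frequently
  exact pow_ne_zero m (ne_of_gt hx)

/-- The stages of a step of size `h` for the chain `shiftField`: `uₖ` has the `i`-th stage
`h ^ k (A ^ k e)_i`. -/
noncomputable def shiftStages (M : RKScheme s) (n : ℕ) (h : ℝ) (i : Fin s) :
    EuclideanSpace ℝ (Fin (n + 1)) :=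
  WithLp.toLp 2 fun k => h ^ (k : ℕ) * (M.A ^ (k : ℕ) *ᵥ 1) i

theorem step_shiftStages_apply_succ (M : RKScheme s) {n : ℕ} (w : Fin s → ℝ) (h : ℝ) (k : Fin n) :
    (shiftSolution n 0 + h • ∑ j, w j • shiftField n (M.shiftStages n h j)) k.succ =
      (w ⬝ᵥ (M.A ^ (k : ℕ) *ᵥ 1)) * h ^ ((k : ℕ) + 1) := by
  simp only [shiftStages, PiLp.add_apply, PiLp.smul_apply, WithLp.ofLp_sum, WithLp.ofLp_smul,
    Finset.sum_apply, Pi.smul_apply, shiftSolution_apply, shiftField_apply_succ, Fin.val_succ,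
    Fin.val_castSucc, dotProduct, smul_eq_mul, Finset.mul_sum, Finset.sum_mul]
  rw [zero_pow (Nat.succ_ne_zero _), zero_div, zero_add]
  exact Finset.sum_congr rfl fun j _ => by ring

theorem shiftStages_eq_step (M : RKScheme s) (n : ℕ) (h : ℝ) (i : Fin s) :
    M.shiftStages n h i =
      shiftSolution n 0 + h • ∑ j, M.A i j • shiftField n (M.shiftStages n h j) := by
  ext k
  cases k using Fin.cases with
  | zero => simp [shiftStages, shiftSolution_apply, shiftField_apply_zero]
  | succ k =>
    rw [step_shiftStages_apply_succ, ← Matrix.mulVec, Matrix.mulVec_mulVec, ← pow_succ', mul_comm]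
    rfl

theorem HasOrder.hasLinearOrder {p : ℕ} (hp : M.HasOrder p) : M.HasLinearOrder p := by
  rintro (_ | n) hn
  · simp [stabilityFunction]
  have hcont (i : Fin s) : Continuous fun h => M.shiftStages (n + 1) h i := by
    unfold shiftStages
    fun_prop
  have hstart (i : Fin s) : M.shiftStages (n + 1) 0 i = shiftSolution (n + 1) 0 := by
    simpa using M.shiftStages_eq_step (n + 1) 0 i
  have herror := hp (n + 2) (fun _ => shiftField (n + 1)) 0 (shiftSolution (n + 1))
    (M.shiftStages (n + 1)) ((contDiff_shiftField _).comp contDiff_snd)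
    (Filter.Eventually.of_forall (hasDerivAt_shiftSolution _))
    (Filter.Eventually.of_forall (M.shiftStages_eq_step _))
    fun i => ((hcont i).tendsto' 0 _ (hstart i)).mono_left nhdsWithin_le_nhds
  have hlast := (Asymptotics.isBigO_of_le _ fun h =>
    PiLp.norm_apply_le _ (Fin.last n).succ).trans herror
  have hcoeff : M.b ⬝ᵥ (M.A ^ n *ᵥ 1) - 1 / ((n + 1).factorial : ℝ) = 0 := by
    refine eq_zero_of_const_mul_pow_isBigO_pow (Nat.lt_succ_of_le hn)
      (hlast.congr_left fun h => ?_)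
    rw [PiLp.sub_apply, step_shiftStages_apply_succ, shiftSolution_apply, Fin.val_succ,
      Fin.val_last, zero_add]
    ring
  rw [coeff_succ_stabilityFunction, sub_eq_zero.1 hcoeff, PowerSeries.coeff_exp]
  simp

/-- The residual `A P'(c) - P(c)` of the stages for the scalar problem `u' = P'(t)` started at
`P 0 = 0`. -/
noncomputable def residual (M : RKScheme s) : ℝ[X] →ₗ[ℝ] (Fin s → ℝ) :=
  M.A.mulVecLin ∘ₗ LinearMap.pi (fun j => leval (M.c j)) ∘ₗ derivative -
    LinearMap.pi fun i => leval (M.c i)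

theorem residual_apply (M : RKScheme s) (P : ℝ[X]) (i : Fin s) :
    M.residual P i = ∑ j, M.A i j * (derivative P).eval (M.c j) - P.eval (M.c i) :=
  rfl

theorem residual_monomial_succ (M : RKScheme s) (k : ℕ) (a : ℝ) :
    M.residual (monomial (k + 1) a) = (a * (k + 1)) • M.tau (k + 1) := by
  ext i
  have hk : (k : ℝ) + 1 ≠ 0 := by positivity
  simp only [residual_apply, tau, derivative_monomial, eval_monomial, Pi.smul_apply, smul_eq_mul,
    Nat.add_sub_cancel, Nat.cast_add, Nat.cast_one, mul_sub, Finset.mul_sum]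
  congr 1
  · exact Finset.sum_congr rfl fun j _ => by ring
  · field_simp

theorem WSOCondition.tau_mem_unobservable {q : ℕ} (h : M.WSOCondition q) {k : ℕ} (hk : 1 ≤ k)
    (hkq : k ≤ q) : M.tau k ∈ M.unobservable :=
  mem_unobservable_of_forall_lt fun j hj => h j k hj hk hkq

theorem WSOCondition.residual_mem_unobservable {q : ℕ} (h : M.WSOCondition q) {P : ℝ[X]}
    (hdeg : P.natDegree ≤ q) (h0 : P.eval 0 = 0) : M.residual P ∈ M.unobservable := by
  rw [P.as_sum_range' (q + 1) (Nat.lt_succ_of_le hdeg), Finset.sum_range_succ',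
    coeff_zero_eq_eval_zero, h0, monomial_zero_right, add_zero, map_sum]
  refine Submodule.sum_mem _ fun k hk => ?_
  rw [residual_monomial_succ]
  exact Submodule.smul_mem _ _
    (h.tau_mem_unobservable k.succ_pos (Nat.succ_le_of_lt (Finset.mem_range.1 hk)))

theorem IsDIRK.residual_apply_of_eval_derivative_eq_zero (hM : M.IsDIRK) {P : ℝ[X]} {k : Fin s}
    (hP : ∀ j < k, (derivative P).eval (M.c j) = 0) :
    M.residual P k = M.A k k * (derivative P).eval (M.c k) - P.eval (M.c k) := by
  rw [residual_apply, Fintype.sum_eq_single k fun j hj => ?_]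
  rcases lt_or_gt_of_ne hj with hj | hj
  · rw [hP j hj, mul_zero]
  · rw [hM k j hj, zero_mul]

/-- The values of the abscissas of the stages before stage `k`. -/
noncomputable def previousAbscissas (M : RKScheme s) (k : Fin s) : Finset ℝ :=
  (Finset.univ.filter (· < k)).image M.c

theorem mem_previousAbscissas {k : Fin s} {x : ℝ} :
    x ∈ M.previousAbscissas k ↔ ∃ j < k, M.c j = x := by
  simp [previousAbscissas]

theorem IsDIRK.exists_pivot_mem_unobservable (hM : M.IsDIRK) {q : ℕ} (h : M.WSOCondition q)
    {k : Fin s} (hk : M.c k ∉ M.previousAbscissas k) (hkk : M.c k = 0 → M.A k k ≠ 0)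
    (hq : 2 * (M.previousAbscissas k).card +
      (if 0 ∈ insert (M.c k) (M.previousAbscissas k) then 1 else 2) ≤ q) :
    ∃ w ∈ M.unobservable, w k ≠ 0 ∧ ∀ j < k, w j = 0 := by
  obtain ⟨P, hdeg, hP0, hzeros, hne⟩ := exists_double_zeros_and_mul_eval_derivative_ne hk hkk
  have hzeros (j : Fin s) (hj : j < k) := hzeros _ (mem_previousAbscissas.2 ⟨j, hj, rfl⟩)
  refine ⟨M.residual P, h.residual_mem_unobservable (hdeg.trans hq) hP0, ?_, fun j hj => ?_⟩
  · rw [hM.residual_apply_of_eval_derivative_eq_zero fun j hj => (hzeros j hj).2]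
    exact sub_ne_zero.2 hne
  · rw [hM.residual_apply_of_eval_derivative_eq_zero fun i hi => (hzeros i (hi.trans hj)).2,
      (hzeros j hj).1, (hzeros j hj).2, mul_zero, sub_zero]

theorem exists_card_previousAbscissas_eq {r : ℕ} (hr : r < M.numAbscissas) :
    ∃ k, M.c k ∉ M.previousAbscissas k ∧ (M.previousAbscissas k).card = r := by
  obtain ⟨k, -, hk⟩ := exists_card_image_filter_lt_eq M.c hr
  exact ⟨k, hk⟩

theorem IsDIRK.card_le_finrank_unobservable (hM : M.IsDIRK) {q : ℕ} (h : M.WSOCondition q)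
    {T : Finset ℕ} (hT : ∀ r ∈ T, r < M.numAbscissas)
    (hpivot : ∀ k, M.c k ∉ M.previousAbscissas k → (M.previousAbscissas k).card ∈ T →
      (M.c k = 0 → M.A k k ≠ 0) ∧ 2 * (M.previousAbscissas k).card +
        (if 0 ∈ insert (M.c k) (M.previousAbscissas k) then 1 else 2) ≤ q) :
    T.card ≤ Module.finrank ℝ M.unobservable := by
  classical
  set pivots := Finset.univ.filter fun k : Fin s => ∃ w ∈ M.unobservable, w k ≠ 0 ∧ ∀ j < k, w j = 0
  have hsub : T ⊆ pivots.image fun k => (M.previousAbscissas k).card := fun r hr => by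
    obtain ⟨k, hk, rfl⟩ := exists_card_previousAbscissas_eq (hT r hr)
    obtain ⟨hkk, hq⟩ := hpivot k hk hr
    exact Finset.mem_image_of_mem _ (Finset.mem_filter.2
      ⟨Finset.mem_univ k, hM.exists_pivot_mem_unobservable h hk hkk hq⟩)
  calc T.card ≤ pivots.card := (Finset.card_le_card hsub).trans Finset.card_image_le
    _ ≤ Module.finrank ℝ M.unobservable :=
      card_le_finrank_of_forall_exists_pivot _ _ fun k hk => (Finset.mem_filter.1 hk).2

theorem IsDIRK.half_le_finrank_unobservable (hM : M.IsDIRK) (hG : ¬ M.IsGEDIRK) {q : ℕ}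
    (h : M.WSOCondition q) (hq : q + 1 ≤ 2 * M.numAbscissas) :
    q / 2 ≤ Module.finrank ℝ M.unobservable := by
  rw [← Finset.card_range (q / 2)]
  refine hM.card_le_finrank_unobservable h (fun r hr => ?_) fun k hk hr => ⟨fun hk0 hkk => ?_, ?_⟩
  · have := Finset.mem_range.1 hr
    lia
  · exact hG ⟨hM, k, hk0, fun j hj hj0 => hk (mem_previousAbscissas.2 ⟨j, hj, hj0.trans hk0.symm⟩),
      hkk⟩
  · have := Finset.mem_range.1 hr
    split_ifs <;> lia

theorem card_previousAbscissas_lt {k l : Fin s} (hk : M.c k ∉ M.previousAbscissas k) (hkl : k < l) :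
    (M.previousAbscissas k).card < (M.previousAbscissas l).card := by
  refine Finset.card_lt_card ((Finset.ssubset_iff_of_subset fun x hx => ?_).2
    ⟨M.c k, mem_previousAbscissas.2 ⟨k, hkl, rfl⟩, hk⟩)
  obtain ⟨j, hj, rfl⟩ := mem_previousAbscissas.1 hx
  exact mem_previousAbscissas.2 ⟨j, hj.trans hkl, rfl⟩

/-- Rank the new abscissas by the number of distinct earlier ones. Only one rank is lost: that of
the first zero abscissa, where `a_ℓℓ = 0` prevents a pivot, or, if it comes first, the top rank
`(q - 1) / 2`, where the polynomial may need degree `q + 1`. -/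
theorem IsGEDIRK.half_succ_le_finrank_unobservable_succ (hG : M.IsGEDIRK) {q : ℕ}
    (h : M.WSOCondition q) (hq : q + 1 ≤ 2 * M.numAbscissas) :
    (q + 1) / 2 ≤ Module.finrank ℝ M.unobservable + 1 := by
  obtain ⟨hM, l, hl0, hlt, -⟩ := hG
  set lost := min (M.previousAbscissas l).card ((q - 1) / 2) with hlost
  suffices hT : ((Finset.range ((q + 1) / 2)).erase lost).card ≤ Module.finrank ℝ M.unobservable by
    have := Finset.pred_card_le_card_erase (s := Finset.range ((q + 1) / 2)) (a := lost)
    rw [Finset.card_range] at this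
    lia
  refine hM.card_le_finrank_unobservable h (fun r hr => ?_) fun k hk hr => ?_
  · have := Finset.mem_range.1 (Finset.mem_of_mem_erase hr)
    lia
  obtain ⟨hne, hr⟩ := Finset.mem_erase.1 hr
  rw [Finset.mem_range] at hr
  rcases lt_trichotomy k l with hkl | rfl | hlk
  · have hrank := card_previousAbscissas_lt hk hkl
    refine ⟨fun hk0 => absurd hk0 (hlt k hkl), ?_⟩
    split_ifs <;> lia
  · lia
  · have h0 : 0 ∈ M.previousAbscissas k := mem_previousAbscissas.2 ⟨l, hlk, hl0⟩
    refine ⟨fun hk0 => absurd (hk0 ▸ h0) hk, ?_⟩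
    rw [if_pos (Finset.mem_insert_of_mem h0)]
    lia

theorem IsDIRK.half_add_kappa_le (hM : M.IsDIRK) {q : ℕ} (h : M.WSOCondition q)
    (hq : q + 1 ≤ 2 * M.numAbscissas) :
    (q + M.kappa) / 2 ≤ Module.finrank ℝ M.unobservable + M.kappa := by
  rw [kappa]
  split_ifs with hG
  · exact hG.half_succ_le_finrank_unobservable_succ h hq
  · exact hM.half_le_finrank_unobservable hG h hq

theorem wsoCondition_of_weakStageOrder_eq {q : ℕ} (h : M.weakStageOrder = (q : ℕ∞)) :
    M.WSOCondition q := by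
  have hne : Nonempty {x : ℕ∞ | ∃ ξ : ℕ, x = (ξ : ℕ∞) ∧ M.WSOCondition ξ} :=
    ⟨⟨0, 0, rfl, fun j k _ hk hk0 => absurd hk0 (Nat.not_le_of_lt hk)⟩⟩
  obtain ⟨ξ, hξ, hw⟩ := ENat.sSup_mem_of_nonempty_of_lt_top (h.trans_lt (ENat.natCast_lt_top q))
  rwa [Nat.cast_injective (h.symm.trans hξ)]

theorem IsDIRK.c_eq_zero (hM : M.IsDIRK) (h2 : M.tau 2 = 0) (h3 : M.tau 3 = 0) : M.c = 0 := by
  ext i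
  induction i using WellFoundedLT.induction with
  | ind i ih =>
    have hsum (n : ℕ) (hn : n ≠ 0) : ∑ j, M.A i j * M.c j ^ n = M.A i i * M.c i ^ n := by
      refine Fintype.sum_eq_single i fun j hj => ?_
      rcases lt_or_gt_of_ne hj with hj | hj
      · rw [ih j hj, Pi.zero_apply, zero_pow hn, mul_zero]
      · rw [hM i j hj, zero_mul]
    have h2i : M.A i i * M.c i ^ 1 - M.c i ^ 2 / 2 = 0 := by
      rw [← hsum 1 one_ne_zero]
      exact congrFun h2 i
    have h3i : M.A i i * M.c i ^ 2 - M.c i ^ 3 / 3 = 0 := by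
      rw [← hsum 2 two_ne_zero]
      exact congrFun h3 i
    exact eq_zero_of_pow_eq_zero (n := 3) (by linear_combination 6 * h3i - 6 * M.c i * h2i)

theorem mulVec_one_eq_c (M : RKScheme s) : M.A *ᵥ 1 = M.c :=
  funext fun i => dotProduct_one (M.A i)

theorem sigma_eq_zero_of_c_eq_zero (hc : M.c = 0) : M.sigma = 0 :=
  if_neg fun ⟨hA, l, _⟩ => one_ne_zero <| congrFun (Matrix.mulVec_injective_of_isUnit hA
    ((M.mulVec_one_eq_c.trans hc).trans (Matrix.mulVec_zero M.A).symm)) l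

theorem HasLinearOrder.stageCount_ne_zero {p : ℕ} (hp : M.HasLinearOrder p) (hp1 : 1 ≤ p) :
    s ≠ 0 := by
  rintro rfl
  have h := hp 1 hp1
  simp [stabilityFunction] at h

theorem HasLinearOrder.le_one_of_c_eq_zero {p : ℕ} (hp : M.HasLinearOrder p) (hc : M.c = 0) :
    p ≤ 1 := by
  by_contra! hp2
  have h := hp 2 hp2
  rw [coeff_succ_stabilityFunction, pow_one, mulVec_one_eq_c, hc, dotProduct_zero,
    PowerSeries.coeff_exp] at h
  norm_num at h

theorem HasLinearOrder.c_ne_zero {p : ℕ} (hp : M.HasLinearOrder p)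
    (hps : p + M.sigma = s + 1) : M.c ≠ 0 := by
  intro hc
  have hσ := sigma_eq_zero_of_c_eq_zero hc
  have hp1 := hp.le_one_of_c_eq_zero hc
  exact hp.stageCount_ne_zero (by lia) (by lia)

theorem IsDIRK.weakStageOrder_le_two (hM : M.IsDIRK) {p : ℕ} (hp : M.HasLinearOrder p)
    (hps : p + M.sigma = s + 1) : M.weakStageOrder ≤ 2 := by
  have hW : M.unobservable = ⊥ := by
    have hord := hp.add_finrank_unobservable_add_sigma_le hM.charpoly_splits
    exact Submodule.finrank_eq_zero.1 (by lia)
  refine sSup_le ?_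
  rintro _ ⟨q, rfl, h⟩
  norm_cast
  by_contra! hq
  have htau (k : ℕ) (hk : 1 ≤ k) (hkq : k ≤ q) : M.tau k = 0 := by
    simpa [hW] using h.tau_mem_unobservable hk hkq
  exact hp.c_ne_zero hps (hM.c_eq_zero (htau 2 one_le_two hq.le) (htau 3 (by simp) hq))

end RKScheme

theorem floor_natCast_add_natCast_div_two (m n : ℕ) :
    ⌊((m : ℝ) + (n : ℝ)) / 2⌋ = (((m + n) / 2 : ℕ) : ℤ) := by
  rw [← Nat.floor_div_eq_div (K := ℝ), Int.natCast_floor_eq_floor (by positivity)]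
  push_cast
  rfl

theorem mainTheorem2_general (s : ℕ) (M : RKScheme s) (hM : M.IsDIRK) (p : ℕ)
    (hp : M.HasLinearOrder p) :
    (∀ q : ℕ, M.WSOCondition q → (q : ℤ) ≤ 2 * (M.numAbscissas : ℤ) - 1 →
      ⌊((q : ℝ) + (M.kappa : ℝ)) / 2⌋ - (M.kappa : ℤ) + (p : ℤ)
          ≤ (s : ℤ) + 1 - (M.sigma : ℤ) ∧
      ((p : ℤ) = (s : ℤ) - (M.sigma : ℤ) →
        (¬ M.IsGEDIRK → q ≤ 3) ∧ (M.IsGEDIRK → q ≤ 4))) ∧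
    ((p : ℤ) = (s : ℤ) + 1 - (M.sigma : ℤ) → M.weakStageOrder ≤ 2) := by
  have hord := hp.add_finrank_unobservable_add_sigma_le hM.charpoly_splits
  refine ⟨fun q hq hn => ?_, fun hps => hM.weakStageOrder_le_two hp (by lia)⟩
  have hdim := hM.half_add_kappa_le hq (by lia)
  refine ⟨?_, fun hps => ⟨fun hG => ?_, fun hG => ?_⟩⟩
  · rw [floor_natCast_add_natCast_div_two]
    lia
  · have hκ : M.kappa = 0 := if_neg hG
    lia
  · have hκ : M.kappa = 1 := if_pos hG
    lia

theorem mainTheorem2 (s : ℕ) (M : RKScheme s) (hM : M.IsDIRK) (p : ℕ) (hp : M.HasOrder p) :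
    (∀ q : ℕ, M.weakStageOrder = (q : ℕ∞) → (q : ℤ) ≤ 2 * (M.numAbscissas : ℤ) - 1 →
      ⌊((q : ℝ) + (M.kappa : ℝ)) / 2⌋ - (M.kappa : ℤ) + (p : ℤ)
          ≤ (s : ℤ) + 1 - (M.sigma : ℤ) ∧
      ((p : ℤ) = (s : ℤ) - (M.sigma : ℤ) →
        (¬ M.IsGEDIRK → q ≤ 3) ∧ (M.IsGEDIRK → q ≤ 4))) ∧
    ((p : ℤ) = (s : ℤ) + 1 - (M.sigma : ℤ) →
      (¬ M.IsGEDIRK → M.weakStageOrder ≤ 3) ∧ (M.IsGEDIRK → M.weakStageOrder ≤ 4)) := by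
  obtain ⟨hle, htwo⟩ := mainTheorem2_general s M hM p hp.hasLinearOrder
  exact ⟨fun q hq => hle q (RKScheme.wsoCondition_of_weakStageOrder_eq hq), fun hps =>
    ⟨fun _ => (htwo hps).trans (by norm_num), fun _ => (htwo hps).trans (by norm_num)⟩⟩
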